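/- For each integer $d\ge 2$, let $B^{(d)}$ be the unit ball of $\mathbb R^d$ (Euclidean norm), let $P_1,P_2$ be independent random points, each uniformly distributed on $B^{(d)}$, and let $|P_1P_2|$ be the Euclidean distance between them. For a bounded convex set $K\subset\mathbb R^d$ with nonempty interior, let $$\lambda_d(K):=3\rho_d\,\frac{\mathbb E|Q_1Q_2|^d}{\mathsf V_d(K)},\qquad \rho_d:=\frac{\pi^{d/2}\,\Gamma(d)}{2^{2d-1}\,\Gamma((d+1)/2)\,\Gamma(d+1/2)},$$ where $Q_1,Q_2$ are independent random points uniformly distributed on $K$ and $\mathsf V_d$ is Lebesgue measure on $\mathbb R^d$. Then, as $d\to\infty$, $$\mathbb E|P_1P_2|^d\sim\frac1{\sqrt6}\Big(\frac{8}{3\sqrt3}\Big)^d\qquad\text{and}\qquad \lambda_d(B^{(d)})\sim\sqrt3\,\Big(\frac{2}{3\sqrt3}\Big)^d,$$ where $a_d\sim b_d$ means $a_d/b_d\to1$. -/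

import Mathlib

open MeasureTheory ProbabilityTheory Filter Asymptotics

noncomputable section

/-- The constant `ρ_d = π^{d/2} Γ(d) / (2^{2d-1} Γ((d+1)/2) Γ(d+1/2))`; the exponent `2d - 1` is
taken in `ℝ`. -/
def rhoConst (d : ℕ) : ℝ :=
  Real.pi ^ ((d : ℝ) / 2) * Real.Gamma (d : ℝ) /
    ((2 : ℝ) ^ (2 * (d : ℝ) - 1) * Real.Gamma (((d : ℝ) + 1) / 2) * Real.Gamma ((d : ℝ) + 1 / 2))

/-- `E |P₁P₂|^d` for `P₁, P₂` independent and uniformly distributed on `K ⊆ ℝ^d`: the pair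
`(P₁, P₂)` has as its law the product of two copies of the normalized Lebesgue measure on `K`. -/
def meanDistPow (d : ℕ) (K : Set (EuclideanSpace ℝ (Fin d))) : ℝ :=
  ∫ p : EuclideanSpace ℝ (Fin d) × EuclideanSpace ℝ (Fin d), ‖p.1 - p.2‖ ^ d
    ∂((cond volume K).prod (cond volume K))

/-- The elongation `λ_d(K) = 3 ρ_d E|P₁P₂|^d / V_d(K)` of a set `K ⊆ ℝ^d`, where `V_d` is
Lebesgue measure. -/
def elongation (d : ℕ) (K : Set (EuclideanSpace ℝ (Fin d))) : ℝ :=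
  3 * rhoConst d * (meanDistPow d K / volume.real K)

/-- The (closed) unit ball `B^{(d)}` of `ℝ^d` for the Euclidean norm. -/
def unitBall (d : ℕ) : Set (EuclideanSpace ℝ (Fin d)) := Metric.closedBall 0 1

end

/-! Both asymptotics follow from closed Gamma-function formulas. Write the two points of the ball as
`y + w` and `y - w`. For fixed `w` the midpoint `y` ranges over a lens, the intersection of two unit
balls, and slicing it perpendicular to `w` gives its volume as a one-dimensional integral over `s >
‖w‖` (`volume_lens`). Exchanging the order of integration leaves the moment of `‖w‖ ^ d` over the
ball of radius `s`, then a Beta integral in `s` (`lintegral_norm_sub_pow_unitBall`). This evaluates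
the mean exactly (`meanDistPow_unitBall`), and the duplication formula simplifies the elongation
(`elongation_unitBall`).

The limits then need Stirling at half-integers, obtained from Stirling for factorials, the
duplication formula and `Γ(x + 1/2) ~ √x Γ(x)`. -/

/-! ### Slicing and the volume of a lens -/

/-- Cavalieri's principle along the first coordinate. -/
theorem volume_setOf_tail_norm_sq_le {n : ℕ} {g : ℝ → ℝ} (hg : Measurable g) :
    volume {y : EuclideanSpace ℝ (Fin (n + 1)) | ‖y‖ ^ 2 - y 0 ^ 2 ≤ g (y 0)} =
      ∫⁻ t, volume {z : EuclideanSpace ℝ (Fin n) | ‖z‖ ^ 2 ≤ g t} := by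
  have h1 := PiLp.volume_preserving_toLp (Fin (n + 1))
  have h2 := (volume_preserving_piFinSuccAbove (fun _ : Fin (n + 1) => ℝ) 0).symm
  have hS : MeasurableSet
      {y : EuclideanSpace ℝ (Fin (n + 1)) | ‖y‖ ^ 2 - y 0 ^ 2 ≤ g (y 0)} :=
    measurableSet_le (by fun_prop) (hg.comp (by fun_prop))
  rw [← (h1.comp h2).measure_preimage hS.nullMeasurableSet, Measure.volume_eq_prod,
    Measure.prod_apply ((h1.comp h2).measurable hS)]
  refine lintegral_congr fun t => ?_
  have hT : MeasurableSet {z : EuclideanSpace ℝ (Fin n) | ‖z‖ ^ 2 ≤ g t} :=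
    measurableSet_le (by fun_prop) measurable_const
  rw [← (PiLp.volume_preserving_toLp (Fin n)).measure_preimage hT.nullMeasurableSet]
  congr 1
  ext z
  simp [EuclideanSpace.norm_sq_eq, Fin.sum_univ_succ, MeasurableEquiv.piFinSuccAbove_symm_apply]

theorem volume_setOf_norm_sq_le {n : ℕ} (hn : n ≠ 0) (c : ℝ) :
    volume {z : EuclideanSpace ℝ (Fin n) | ‖z‖ ^ 2 ≤ c} =
      volume (unitBall n) * ENNReal.ofReal (√c ^ n) := by
  rcases le_or_gt 0 c with hc | hc
  · have : {z : EuclideanSpace ℝ (Fin n) | ‖z‖ ^ 2 ≤ c} = Metric.closedBall 0 (√c) := by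
      ext z
      simp [Real.le_sqrt (norm_nonneg z)  hc]
    rw [this, Measure.addHaar_closedBall' _ _ (Real.sqrt_nonneg c), unitBall, mul_comm]
    simp
  · have : {z : EuclideanSpace ℝ (Fin n) | ‖z‖ ^ 2 ≤ c} = ∅ := by
      ext z
      simpa using hc.trans_le (sq_nonneg ‖z‖)
    -- For `c < 0` the root `√c` is `0` by convention, so `n ≠ 0` makes the right side vanish.
    simp [this, Real.sqrt_eq_zero_of_nonpos hc.le, hn]

theorem lintegral_comp_add_abs (f : ℝ → ENNReal) (r : ℝ) :
    ∫⁻ t, f (r + |t|) = 2 * ∫⁻ s in Set.Ioi r, f s := by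
  have h1 : ∫⁻ t in Set.Ioi (0 : ℝ), f (r + |t|) = ∫⁻ s in Set.Ioi r, f s := by
    have := (measurePreserving_add_left (volume : Measure ℝ) r).setLIntegral_comp_preimage_emb
      (measurableEmbedding_addLeft r) f (Set.Ioi r)
    rw [← this]
    simp only [Set.preimage_const_add_Ioi, sub_self]
    refine setLIntegral_congr_fun measurableSet_Ioi fun t (ht : 0 < t) => ?_
    simp [abs_of_pos ht]
  have h2 : ∫⁻ t in (Set.Ioi (0 : ℝ))ᶜ, f (r + |t|) = ∫⁻ t in Set.Ioi (0 : ℝ), f (r + |t|) := by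
    rw [Set.compl_Ioi, setLIntegral_congr Iio_ae_eq_Iic.symm]
    have := (Measure.measurePreserving_neg (volume : Measure ℝ)).setLIntegral_comp_preimage_emb
      (MeasurableEquiv.neg ℝ).measurableEmbedding (fun t => f (r + |t|)) (Set.Ioi 0)
    rw [← this]
    simp
  rw [← lintegral_add_compl _ (measurableSet_Ioi (a := (0 : ℝ))), h2, h1, two_mul]

/-- The reflection in the hyperplane orthogonal to the difference of two vectors of equal norm swaps
them. -/
theorem exists_linearIsometryEquiv_norm_smul_single {n : ℕ} (w : EuclideanSpace ℝ (Fin (n + 1))) :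
    ∃ φ : EuclideanSpace ℝ (Fin (n + 1)) ≃ₗᵢ[ℝ] EuclideanSpace ℝ (Fin (n + 1)),
      φ (EuclideanSpace.single 0 ‖w‖) = w :=
  ⟨_, Submodule.reflection_sub (by simp)⟩

theorem measurableSet_lens {d : ℕ} (w : EuclideanSpace ℝ (Fin d)) :
    MeasurableSet {y | y + w ∈ unitBall d ∧ y - w ∈ unitBall d} := by
  simp only [unitBall, mem_closedBall_zero_iff]
  exact (measurableSet_le (f := fun y => ‖y + w‖) (by fun_prop) measurable_const).inter
    (measurableSet_le (f := fun y => ‖y - w‖) (by fun_prop) measurable_const)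

/-- Rotate `w` onto the first axis. At height `y 0 = t` the more restrictive ball cuts out an
`n`-ball of squared radius `1 - (‖w‖ + |t|) ^ 2`; then `s = ‖w‖ + |t|`. No upper limit `1` is
needed, as the root vanishes beyond it. -/
theorem volume_lens {n : ℕ} (hn : n ≠ 0) (w : EuclideanSpace ℝ (Fin (n + 1))) :
    volume {y | y + w ∈ unitBall (n + 1) ∧ y - w ∈ unitBall (n + 1)} =
      2 * volume (unitBall n) *
        ∫⁻ s in Set.Ioi ‖w‖, ENNReal.ofReal (√(1 - s ^ 2) ^ n) := by
  obtain ⟨φ, hφ⟩ := exists_linearIsometryEquiv_norm_smul_single w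
  have hS := measurableSet_lens w
  rw [← φ.measurePreserving.measure_preimage hS.nullMeasurableSet]
  have h : φ ⁻¹' {y | y + w ∈ unitBall (n + 1) ∧ y - w ∈ unitBall (n + 1)} =
      {y | ‖y‖ ^ 2 - y 0 ^ 2 ≤ 1 - (‖w‖ + |y 0|) ^ 2} := by
    ext y
    have h1 : ‖φ y + w‖ = ‖y + EuclideanSpace.single 0 ‖w‖‖ := by
      conv_lhs => rw [← hφ, ← map_add, φ.norm_map]
    have h2 : ‖φ y - w‖ = ‖y - EuclideanSpace.single 0 ‖w‖‖ := by
      conv_lhs => rw [← hφ, ← map_sub, φ.norm_map]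
    have h3 : ∀ a : ℝ, 0 ≤ a → (a ≤ 1 ↔ a ^ 2 ≤ 1) := fun a ha => by
      rw [sq_le_one_iff₀ ha]
    simp only [unitBall, Set.mem_preimage, Set.mem_ofPred_eq, mem_closedBall_zero_iff, h1, h2]
    rw [h3 _ (norm_nonneg _), h3 _ (norm_nonneg _), norm_add_sq_real, norm_sub_sq_real]
    simp only [PiLp.norm_single, EuclideanSpace.inner_single_right, norm_norm]
    simp only [conj_trivial]
    have h4 : |y 0| ^ 2 = y 0 ^ 2 := sq_abs _
    have hw := norm_nonneg w
    constructor
    · rintro ⟨h5, h6⟩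
      rcases abs_cases (y 0) with ⟨h, -⟩ | ⟨h, -⟩ <;> rw [h] <;> nlinarith
    · intro h5
      have h6 := mul_le_mul_of_nonneg_left (le_abs_self (y 0)) hw
      have h7 := mul_le_mul_of_nonneg_left (neg_le_abs (y 0)) hw
      constructor <;> nlinarith
  rw [h, volume_setOf_tail_norm_sq_le (g := fun t => 1 - (‖w‖ + |t|) ^ 2) (by fun_prop)]
  simp_rw [volume_setOf_norm_sq_le hn]
  rw [lintegral_const_mul _ (by fun_prop),
    lintegral_comp_add_abs (fun s => ENNReal.ofReal (√(1 - s ^ 2) ^ n))]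
  ring

/-! ### The radial moment and the Beta integral -/

theorem lintegral_ball_norm_pow {d : ℕ} (hd : d ≠ 0) {s : ℝ} (hs : 0 ≤ s) :
    ∫⁻ w in Metric.ball (0 : EuclideanSpace ℝ (Fin d)) s, ENNReal.ofReal (‖w‖ ^ d) =
      volume (unitBall d) * ENNReal.ofReal (s ^ (2 * d) / 2) := by
  have : Nonempty (Fin d) := Fin.pos_iff_nonempty.mp (Nat.pos_of_ne_zero hd)
  have hint : IntegrableOn (fun w => ‖w‖ ^ d) (Metric.ball (0 : EuclideanSpace ℝ (Fin d)) s) :=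
    ((by fun_prop : Continuous fun w : EuclideanSpace ℝ (Fin d) =>
      ‖w‖ ^ d).continuousOn.integrableOn_compact (isCompact_closedBall 0 s)).mono_set Metric.ball_subset_closedBall
  rw [← ofReal_integral_eq_lintegral_ofReal hint (ae_of_all _ fun w => by positivity)]
  have h := integral_fun_norm_addHaar (volume : Measure (EuclideanSpace ℝ (Fin d)))
    ((Set.Iio s).indicator fun r => r ^ d)
  have h1 : ∫ w in Metric.ball (0 : EuclideanSpace ℝ (Fin d)) s, ‖w‖ ^ d =
      ∫ w : EuclideanSpace ℝ (Fin d), (Set.Iio s).indicator (fun r => r ^ d) ‖w‖ := by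
    rw [← integral_indicator Metric.isOpen_ball.measurableSet]
    refine integral_congr_ae (ae_of_all _ fun w => ?_)
    simp [Set.indicator]
  have h2 : ∫ y in Set.Ioi (0 : ℝ), y ^ (d - 1) • (Set.Iio s).indicator (fun r => r ^ d) y =
      s ^ (2 * d) / (2 * d) := by
    have h3 : ∀ y : ℝ, y ^ (d - 1) • (Set.Iio s).indicator (fun r => r ^ d) y =
        (Set.Iio s).indicator (fun r => r ^ (2 * d - 1)) y := fun y => by
      by_cases hy : y < s
      · simp only [Set.indicator, Set.mem_Iio, hy, if_true, smul_eq_mul, ← pow_add]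
        congr 1
        omega
      · simp [hy]
    simp_rw [h3]
    rw [setIntegral_indicator measurableSet_Iio, Set.Ioi_inter_Iio,
      ← integral_Ioc_eq_integral_Ioo, ← intervalIntegral.integral_of_le hs, integral_pow]
    have h4 : 2 * d - 1 + 1 = 2 * d := by omega
    have h5 : ((2 * d - 1 : ℕ) : ℝ) + 1 = 2 * d := by exact_mod_cast h4
    rw [h4, h5, zero_pow (by omega), sub_zero]
  rw [h1, h, finrank_euclideanSpace_fin, h2, nsmul_eq_mul, smul_eq_mul]
  have h6 : (volume (unitBall d)) =
      ENNReal.ofReal (volume.real (Metric.ball (0 : EuclideanSpace ℝ (Fin d)) 1)) := by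
    rw [unitBall, Measure.addHaar_closedBall_eq_addHaar_ball, ofReal_measureReal]
  rw [h6, ← ENNReal.ofReal_mul (by positivity)]
  congr 1
  field_simp

/-- The substitution `u = s ^ 2` turns the integrand into a multiple of a Beta density, whose total
mass is `1`. -/
theorem lintegral_pow_mul_sqrt_one_sub_sq_pow (d : ℕ) {n : ℕ} (hn : n ≠ 0) :
    ∫⁻ s in Set.Ioi (0 : ℝ), ENNReal.ofReal (s ^ (2 * d) * √(1 - s ^ 2) ^ n) =
      ENNReal.ofReal (beta (d + 1 / 2) (n / 2 + 1) / 2) := by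
  have hα : (0 : ℝ) < d + 1 / 2 := by positivity
  have hβ : (0 : ℝ) < n / 2 + 1 := by positivity
  have hB := beta_pos hα hβ
  set B := beta (d + 1 / 2) (n / 2 + 1) with hBdef
  have hsq : (fun s : ℝ => s ^ 2) '' Set.Ioo 0 1 = Set.Ioo 0 1 := by
    ext u
    constructor
    · rintro ⟨s, ⟨h0, h1⟩, rfl⟩
      exact ⟨by positivity, by nlinarith⟩
    · rintro ⟨h0, h1⟩
      exact ⟨√u, ⟨Real.sqrt_pos.2 h0, by rw [Real.sqrt_lt' one_pos]; simpa using h1⟩,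
        Real.sq_sqrt h0.le⟩
  have hone := lintegral_betaPDF_eq_one hα hβ
  rw [lintegral_betaPDF, ← hBdef, ← hsq, lintegral_image_eq_lintegral_abs_deriv_mul
    measurableSet_Ioo (f' := fun s => 2 * s)
    (fun s _ => by simpa using (hasDerivAt_pow 2 s).hasDerivWithinAt)
    (fun s hs t ht h => (pow_left_inj₀ hs.1.le ht.1.le two_ne_zero).1 h)] at hone
  have hsplit : ∫⁻ s in Set.Ioi (0 : ℝ), ENNReal.ofReal (s ^ (2 * d) * √(1 - s ^ 2) ^ n) =
      ∫⁻ s in Set.Ioo (0 : ℝ) 1, ENNReal.ofReal (s ^ (2 * d) * √(1 - s ^ 2) ^ n) := by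
    rw [← Set.Ioi_inter_Iio, Set.inter_comm, ← setLIntegral_indicator measurableSet_Iio]
    refine lintegral_congr fun s => ?_
    by_cases hs : s < 1
    · simp [hs]
    · rw [Set.indicator_of_notMem (by simpa using hs),
        Real.sqrt_eq_zero_of_nonpos (by nlinarith), zero_pow hn]
      simp
  have hcongr : ∀ s ∈ Set.Ioo (0 : ℝ) 1, ENNReal.ofReal |2 * s| * ENNReal.ofReal
      (1 / B * (s ^ 2) ^ ((d : ℝ) + 1 / 2 - 1) * (1 - s ^ 2) ^ ((n : ℝ) / 2 + 1 - 1)) =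
      ENNReal.ofReal (2 / B) * ENNReal.ofReal (s ^ (2 * d) * √(1 - s ^ 2) ^ n) := by
    rintro s ⟨h0, h1⟩
    have h2 : 0 ≤ 1 - s ^ 2 := by nlinarith
    rw [← ENNReal.ofReal_mul (by positivity), ← ENNReal.ofReal_mul (by positivity),
      abs_of_pos (by positivity)]
    congr 1
    have h3 : (1 - s ^ 2) ^ ((n : ℝ) / 2 + 1 - 1) = √(1 - s ^ 2) ^ n := by
      rw [Real.sqrt_eq_rpow, ← Real.rpow_natCast _ n, ← Real.rpow_mul h2]
      congr 1
      ring
    have h4 : (s ^ 2) ^ ((d : ℝ) + 1 / 2 - 1) * s = s ^ (2 * d) := by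
      rw [← Real.rpow_natCast s 2, ← Real.rpow_mul h0.le, ← Real.rpow_add_one h0.ne',
        ← Real.rpow_natCast s (2 * d)]
      congr 1
      push_cast
      ring
    rw [h3, ← h4]
    ring
  rw [setLIntegral_congr_fun measurableSet_Ioo hcongr, lintegral_const_mul _ (by fun_prop)] at hone
  rw [hsplit]
  have h5 : ENNReal.ofReal (B / 2) * ENNReal.ofReal (2 / B) = 1 := by
    rw [← ENNReal.ofReal_mul (by positivity), div_mul_div_cancel₀ two_ne_zero, div_self hB.ne',
      ENNReal.ofReal_one]
  rw [← one_mul (∫⁻ s in Set.Ioo (0 : ℝ) 1, _), ← h5, mul_assoc, hone, mul_one]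

/-! ### Midpoint coordinates and the exact mean -/

theorem lintegral_lintegral_eq_sum_difference {E : Type*} [NormedAddCommGroup E] [NormedSpace ℝ E]
    [FiniteDimensional ℝ E] [MeasurableSpace E] [BorelSpace E] (μ : Measure E)
    [μ.IsAddHaarMeasure] {f : E × E → ENNReal} (hf : Measurable f) :
    ∫⁻ p, f p ∂(μ.prod μ) =
      2 ^ Module.finrank ℝ E * ∫⁻ w, ∫⁻ y, f (y + w, y - w) ∂μ ∂μ := by
  have h1 : ∀ y, ∫⁻ x, f (x, y) ∂μ =
      2 ^ Module.finrank ℝ E * ∫⁻ w, f (y + (2 : ℝ) • w, y) ∂μ := fun y => by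
    have hm : Measurable fun x => f (y + x, y) := by fun_prop
    rw [← lintegral_add_left_eq_self (fun x => f (x, y)) y,
      ← lintegral_map (f := fun x => f (y + x, y)) (g := fun w : E => (2 : ℝ) • w) hm (by fun_prop),
      Measure.map_addHaar_smul μ (two_ne_zero' ℝ), lintegral_smul_measure, smul_eq_mul,
      ← mul_assoc, abs_of_pos (by positivity), ENNReal.ofReal_inv_of_pos (by positivity),
      ENNReal.ofReal_pow (by positivity), ENNReal.ofReal_ofNat, ENNReal.mul_inv_cancel, one_mul]
    · exact pow_ne_zero _ two_ne_zero
    · exact ENNReal.pow_ne_top ENNReal.ofNat_ne_top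
  rw [lintegral_prod_symm' _ hf]
  simp_rw [h1]
  rw [lintegral_const_mul _ (Measurable.lintegral_prod_right' (f := fun q : E × E =>
    f (q.1 + (2 : ℝ) • q.2, q.1)) (by fun_prop)),
    lintegral_lintegral_swap (by fun_prop)]
  congr 1
  refine lintegral_congr fun w => ?_
  -- Translating by `w` makes `y` the midpoint of the pair.
  rw [← lintegral_sub_right_eq_self (fun y => f (y + (2 : ℝ) • w, y)) w]
  refine lintegral_congr fun y => ?_
  rw [two_smul]
  congr 2
  abel

/-- The factor `4 ^ (n + 1)` is the Jacobian `2 ^ (n + 1)` times the same power of two from `‖p.1 -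
p.2‖ = 2 ‖w‖`. -/
theorem lintegral_norm_sub_pow_unitBall {n : ℕ} (hn : n ≠ 0) :
    ∫⁻ p in unitBall (n + 1) ×ˢ unitBall (n + 1), ENNReal.ofReal (‖p.1 - p.2‖ ^ (n + 1)) =
      4 ^ (n + 1) * volume (unitBall n) * volume (unitBall (n + 1)) *
        ENNReal.ofReal (beta ((n + 1 : ℕ) + 1 / 2) (n / 2 + 1) / 2) := by
  have hU : MeasurableSet (unitBall (n + 1)) := Metric.isClosed_closedBall.measurableSet
  have hf : Measurable fun p : EuclideanSpace ℝ (Fin (n + 1)) × EuclideanSpace ℝ (Fin (n + 1)) =>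
      ENNReal.ofReal (‖p.1 - p.2‖ ^ (n + 1)) := by fun_prop
  rw [← lintegral_indicator (hU.prod hU), Measure.volume_eq_prod,
    lintegral_lintegral_eq_sum_difference _ (hf.indicator (hU.prod hU)),
    finrank_euclideanSpace_fin]
  have h1 : ∀ w : EuclideanSpace ℝ (Fin (n + 1)),
      ∫⁻ y, (unitBall (n + 1) ×ˢ unitBall (n + 1)).indicator
        (fun p => ENNReal.ofReal (‖p.1 - p.2‖ ^ (n + 1))) (y + w, y - w) =
      2 ^ (n + 1) * (2 * volume (unitBall n)) * (ENNReal.ofReal (‖w‖ ^ (n + 1)) *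
        ∫⁻ s in Set.Ioi ‖w‖, ENNReal.ofReal (√(1 - s ^ 2) ^ n)) := fun w => by
    have hS := measurableSet_lens w
    have h2 : ∀ y, (unitBall (n + 1) ×ˢ unitBall (n + 1)).indicator
        (fun p => ENNReal.ofReal (‖p.1 - p.2‖ ^ (n + 1))) (y + w, y - w) =
        {y | y + w ∈ unitBall (n + 1) ∧ y - w ∈ unitBall (n + 1)}.indicator
          (fun _ => 2 ^ (n + 1) * ENNReal.ofReal (‖w‖ ^ (n + 1))) y := fun y => by
      have h3 : y + w - (y - w) = (2 : ℝ) • w := by rw [two_smul]; abel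
      simp only [Set.indicator, Set.mem_prod, Set.mem_ofPred_eq, h3, norm_smul, mul_pow]
      rw [ENNReal.ofReal_mul (by positivity), ENNReal.ofReal_pow (by positivity)]
      simp only [Real.norm_ofNat, ENNReal.ofReal_ofNat]
      rfl
    simp_rw [h2]
    rw [lintegral_indicator_const hS, volume_lens hn]
    ring
  simp_rw [h1]
  have hm : Measurable fun q : EuclideanSpace ℝ (Fin (n + 1)) × ℝ =>
      (Set.Ioi ‖q.1‖).indicator (fun s => ENNReal.ofReal (√(1 - s ^ 2) ^ n)) q.2 *
        ENNReal.ofReal (‖q.1‖ ^ (n + 1)) := by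
    refine Measurable.mul ?_ (by fun_prop)
    exact (by fun_prop : Measurable fun q : EuclideanSpace ℝ (Fin (n + 1)) × ℝ =>
      ENNReal.ofReal (√(1 - q.2 ^ 2) ^ n)).indicator
      (measurableSet_lt (by fun_prop) (by fun_prop) :
        MeasurableSet {q : EuclideanSpace ℝ (Fin (n + 1)) × ℝ | ‖q.1‖ < q.2})
  have h4 : ∀ w : EuclideanSpace ℝ (Fin (n + 1)), ENNReal.ofReal (‖w‖ ^ (n + 1)) *
        ∫⁻ s in Set.Ioi ‖w‖, ENNReal.ofReal (√(1 - s ^ 2) ^ n) =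
      ∫⁻ s, (Set.Ioi ‖w‖).indicator (fun s => ENNReal.ofReal (√(1 - s ^ 2) ^ n)) s *
        ENNReal.ofReal (‖w‖ ^ (n + 1)) := fun w => by
    rw [lintegral_mul_const _ (Measurable.indicator (by fun_prop) measurableSet_Ioi),
      lintegral_indicator measurableSet_Ioi, mul_comm]
  -- Once the order is exchanged, the constraint `‖w‖ < s` confines `w` to a ball of radius `s`.
  have h5 : ∀ s : ℝ, ∫⁻ w : EuclideanSpace ℝ (Fin (n + 1)),
      (Set.Ioi ‖w‖).indicator (fun s => ENNReal.ofReal (√(1 - s ^ 2) ^ n)) s *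
        ENNReal.ofReal (‖w‖ ^ (n + 1)) =
      (Set.Ioi (0 : ℝ)).indicator (fun s => volume (unitBall (n + 1)) * ENNReal.ofReal (1 / 2) *
        ENNReal.ofReal (s ^ (2 * (n + 1)) * √(1 - s ^ 2) ^ n)) s := fun s => by
    have h6 : ∀ w : EuclideanSpace ℝ (Fin (n + 1)),
        (Set.Ioi ‖w‖).indicator (fun s => ENNReal.ofReal (√(1 - s ^ 2) ^ n)) s *
          ENNReal.ofReal (‖w‖ ^ (n + 1)) =
        ENNReal.ofReal (√(1 - s ^ 2) ^ n) * (Metric.ball 0 s).indicator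
          (fun w => ENNReal.ofReal (‖w‖ ^ (n + 1))) w := fun w => by
      by_cases h : ‖w‖ < s <;> simp [h]
    simp_rw [h6]
    rw [lintegral_const_mul _ (Measurable.indicator (by fun_prop) Metric.isOpen_ball.measurableSet),
      lintegral_indicator Metric.isOpen_ball.measurableSet]
    by_cases hs : 0 < s
    · rw [lintegral_ball_norm_pow n.succ_ne_zero hs.le, Set.indicator_of_mem (by exact hs),
        ENNReal.ofReal_mul (by positivity), div_eq_mul_one_div,
        ENNReal.ofReal_mul (by positivity)]
      ring
    · rw [Metric.ball_eq_empty.2 (not_lt.1 hs), Set.indicator_of_notMem (by simpa using hs)]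
      simp
  rw [lintegral_const_mul _ (by
    simp_rw [h4]
    exact Measurable.lintegral_prod_right' hm)]
  simp_rw [h4]
  rw [lintegral_lintegral_swap hm.aemeasurable]
  simp_rw [h5]
  rw [lintegral_indicator measurableSet_Ioi, lintegral_const_mul _ (by fun_prop),
    lintegral_pow_mul_sqrt_one_sub_sq_pow _ hn]
  have h7 : (2 : ENNReal) * ENNReal.ofReal (1 / 2) = 1 := by
    rw [← ENNReal.ofReal_ofNat, ← ENNReal.ofReal_mul (by positivity)]
    norm_num
  have h8 : (4 : ENNReal) ^ (n + 1) = 2 ^ (n + 1) * 2 ^ (n + 1) := by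
    rw [← mul_pow]
    norm_num
  rw [h8]
  set β := ENNReal.ofReal (beta ((n + 1 : ℕ) + 1 / 2) (n / 2 + 1) / 2)
  calc _ = 2 ^ (n + 1) * 2 ^ (n + 1) * volume (unitBall n) * volume (unitBall (n + 1)) * β *
        (2 * ENNReal.ofReal (1 / 2)) := by ring
    _ = _ := by rw [h7, mul_one]

theorem volume_unitBall {d : ℕ} (hd : d ≠ 0) :
    volume (unitBall d) = ENNReal.ofReal (√Real.pi ^ d / Real.Gamma (d / 2 + 1)) := by
  have : Nonempty (Fin d) := Fin.pos_iff_nonempty.mp (Nat.pos_of_ne_zero hd)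
  simp [unitBall, EuclideanSpace.volume_closedBall]

theorem meanDistPow_unitBall {d : ℕ} (hd : 2 ≤ d) :
    meanDistPow d (unitBall d) = 4 ^ d / (2 * √Real.pi) * (Real.Gamma (d / 2 + 1) *
      Real.Gamma (d + 1 / 2) / Real.Gamma (3 * d / 2 + 1)) := by
  obtain ⟨n, rfl⟩ : ∃ n, d = n + 1 := ⟨d - 1, by omega⟩
  have hn : n ≠ 0 := by omega
  have hG1 : 0 < Real.Gamma (((n + 1 : ℕ) : ℝ) / 2 + 1) := Real.Gamma_pos_of_pos (by positivity)
  have hG2 : 0 < Real.Gamma ((n : ℝ) / 2 + 1) := Real.Gamma_pos_of_pos (by positivity)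
  have hG3 : 0 < Real.Gamma (3 * ((n + 1 : ℕ) : ℝ) / 2 + 1) :=
    Real.Gamma_pos_of_pos (by positivity)
  have hβ : 0 < beta ((n + 1 : ℕ) + 1 / 2) ((n : ℝ) / 2 + 1) := beta_pos (by positivity) (by positivity)
  rw [meanDistPow, integral_eq_lintegral_of_nonneg_ae (ae_of_all _ fun p => by positivity)
    (by fun_prop), ProbabilityTheory.cond, Measure.prod_smul_left, Measure.prod_smul_right, Measure.prod_restrict,
    lintegral_smul_measure, lintegral_smul_measure, ← Measure.volume_eq_prod,
    lintegral_norm_sub_pow_unitBall hn, volume_unitBall hn, volume_unitBall n.succ_ne_zero]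
  simp only [smul_eq_mul, ENNReal.toReal_mul, ENNReal.toReal_inv]
  rw [ENNReal.toReal_ofReal (by positivity), ENNReal.toReal_ofReal (by positivity),
    ENNReal.toReal_ofReal (by positivity), beta]
  have h : ((n + 1 : ℕ) : ℝ) + 1 / 2 + (n / 2 + 1) = 3 * ((n + 1 : ℕ) : ℝ) / 2 + 1 := by
    push_cast
    ring
  have hπ : 0 < √Real.pi := by positivity
  rw [h]
  simp only [ENNReal.toReal_pow, ENNReal.toReal_ofNat]
  field_simp
  rw [← pow_succ]

/-! ### Gamma asymptotics -/

/-- Log-convexity at the midpoint of `x` and `x + 1` bounds the ratio above by `1`; the same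
inequality at `x + 1/2` bounds it below by `√(x / (x + 1/2))`. -/
theorem Gamma_add_half_isEquivalent :
    (fun x : ℝ => Real.Gamma (x + 1 / 2)) ~[atTop] fun x => √x * Real.Gamma x := by
  have hlog : ∀ x : ℝ, 0 < x → Real.Gamma (x + 1 / 2) ≤ √x * Real.Gamma x := fun x hx => by
    have hG := Real.Gamma_pos_of_pos hx
    have h := Real.Gamma_mul_add_mul_le_rpow_Gamma_mul_rpow_Gamma hx (by linarith : 0 < x + 1)
      (half_pos one_pos) (half_pos one_pos) (by norm_num)
    rw [Real.Gamma_add_one hx.ne', ← Real.sqrt_eq_rpow, ← Real.sqrt_eq_rpow,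
      Real.sqrt_mul hx.le, mul_left_comm, Real.mul_self_sqrt hG.le] at h
    convert h using 2
    ring
  have hlim : Tendsto (fun x : ℝ => √(1 - 1 / 2 / (x + 1 / 2))) atTop (nhds 1) := by
    have h : Tendsto (fun x : ℝ => 1 / 2 / (x + 1 / 2)) atTop (nhds 0) :=
      (tendsto_atTop_add_const_right _ _ tendsto_id).const_div_atTop _
    simpa using (h.const_sub 1).sqrt
  refine isEquivalent_of_tendsto_one (tendsto_of_tendsto_of_tendsto_of_le_of_le' hlim
    tendsto_const_nhds ?_ ?_)
  · filter_upwards [eventually_gt_atTop 0] with x hx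
    have hG := Real.Gamma_pos_of_pos hx
    have h := hlog (x + 1 / 2) (by positivity)
    rw [add_assoc, add_halves, Real.Gamma_add_one hx.ne'] at h
    have h1 : √(1 - 1 / 2 / (x + 1 / 2)) = √x / √(x + 1 / 2) := by
      rw [← Real.sqrt_div hx.le]
      congr 1
      field_simp
      ring
    have hs : 0 < √(x + 1 / 2) := by positivity
    have hx' : 0 < √x := by positivity
    rw [h1, Pi.div_apply, div_le_div_iff₀ hs (by positivity)]
    calc √x * (√x * Real.Gamma x) = x * Real.Gamma x := by
          rw [← mul_assoc, Real.mul_self_sqrt hx.le]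
      _ ≤ _ := by linarith
  · filter_upwards [eventually_gt_atTop 0] with x hx
    have hG := Real.Gamma_pos_of_pos hx
    rw [Pi.div_apply]
    exact div_le_one_of_le₀ (hlog x hx) (by positivity)

theorem isEquivalent_sqrt {α : Type*} {l : Filter α} {u v : α → ℝ} (huv : u ~[l] v)
    (hv : ∀ᶠ x in l, 0 < v x) : (fun x => √(u x)) ~[l] fun x => √(v x) := by
  have h := ((isEquivalent_iff_tendsto_one (hv.mono fun _ h => h.ne')).1 huv).sqrt
  refine isEquivalent_of_tendsto_one ?_
  rw [Real.sqrt_one] at h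
  refine h.congr' (hv.mono fun x hx => ?_)
  simp [Real.sqrt_div' _ hx.le]

theorem Gamma_half_add_one_mul_Gamma_half (k : ℕ) :
    Real.Gamma (((k : ℝ) + 1) / 2) * Real.Gamma (k / 2 + 1) =
      k.factorial * √Real.pi / 2 ^ k := by
  have h := Real.Gamma_mul_Gamma_add_half (((k : ℝ) + 1) / 2)
  rw [show ((k : ℝ) + 1) / 2 + 1 / 2 = k / 2 + 1 by ring,
    show 2 * (((k : ℝ) + 1) / 2) = k + 1 by ring, Real.Gamma_nat_eq_factorial,
    show 1 - ((k : ℝ) + 1) = -k by ring, Real.rpow_neg zero_le_two, Real.rpow_natCast] at h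
  rw [h]
  ring

/-- Stirling's formula for the Gamma function at half-integers. -/
theorem Gamma_half_add_one_isEquivalent :
    (fun k : ℕ => Real.Gamma (k / 2 + 1)) ~[atTop]
      fun k => √(Real.pi * k) * √((k / (2 * Real.exp 1)) ^ k) := by
  have hhalf : Tendsto (fun k : ℕ => ((k : ℝ) + 1) / 2) atTop atTop :=
    (tendsto_atTop_add_const_right _ _ tendsto_natCast_atTop_atTop).atTop_div_const two_pos
  have h1 := Gamma_add_half_isEquivalent.comp_tendsto hhalf
  -- One factor of the square is replaced by `√((k + 1) / 2) Γ((k + 1) / 2)`; duplication turns the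
  -- remaining product of Gammas into `k!`.
  have hsq : (fun k : ℕ => Real.Gamma (k / 2 + 1) ^ 2) ~[atTop]
      fun k => Real.pi * k * (k / (2 * Real.exp 1)) ^ k := by
    have h2 : (fun k : ℕ => √(((k : ℝ) + 1) / 2)) ~[atTop] fun k => √((k : ℝ) / 2) := by
      refine isEquivalent_sqrt ?_ (eventually_gt_atTop 0 |>.mono fun k hk => by positivity)
      refine isEquivalent_of_tendsto_one ?_
      have h3 : Tendsto (fun k : ℕ => 1 + (1 : ℝ) / k) atTop (nhds 1) := by
        simpa using (tendsto_const_div_atTop_nhds_zero_nat (1 : ℝ)).const_add 1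
      refine h3.congr' (eventually_gt_atTop 0 |>.mono fun k hk => ?_)
      simp only [Pi.div_apply]
      field_simp
    have h4 := (h2.mul Stirling.factorial_isEquivalent_stirling).mul
      (IsEquivalent.refl (u := fun k : ℕ => √Real.pi / 2 ^ k) (l := atTop))
    have h5 := h1.mul (IsEquivalent.refl (u := fun k : ℕ => Real.Gamma (k / 2 + 1)) (l := atTop))
    refine ((h5.congr_left ?_).congr_right ?_).trans (h4.congr_right ?_)
    · refine .of_forall fun k => ?_
      simp only [Function.comp, Pi.mul_apply]
      rw [show ((k : ℝ) + 1) / 2 + 1 / 2 = k / 2 + 1 by ring, sq]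
    · refine .of_forall fun k => ?_
      simp only [Function.comp, Pi.mul_apply]
      rw [mul_assoc, Gamma_half_add_one_mul_Gamma_half]
      ring
    · refine .of_forall fun k => ?_
      simp only [Pi.mul_apply]
      have hk : (0 : ℝ) ≤ k := k.cast_nonneg
      have h6 : √((k : ℝ) / 2) * √(2 * k * Real.pi) * √Real.pi = Real.pi * k := by
        rw [← Real.sqrt_mul (by positivity), ← Real.sqrt_mul (by positivity),
          Real.sqrt_eq_iff_mul_self_eq (by positivity) (by positivity)]
        ring
      rw [← h6]
      simp only [div_pow, mul_pow]
      field_simp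
  have h := isEquivalent_sqrt hsq (eventually_gt_atTop 0 |>.mono fun k hk => by positivity)
  refine (h.congr_left (.of_forall fun k => ?_)).congr_right (.of_forall fun k => ?_)
  · exact Real.sqrt_sq (Real.Gamma_nonneg_of_nonneg (by positivity))
  · exact Real.sqrt_mul (by positivity) _

theorem Gamma_natCast_add_half_isEquivalent :
    (fun d : ℕ => Real.Gamma (d + 1 / 2)) ~[atTop]
      fun d => √(2 * Real.pi) * (d / Real.exp 1) ^ d := by
  have h := Gamma_add_half_isEquivalent.comp_tendsto (tendsto_natCast_atTop_atTop (R := ℝ))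
  have h1 := Stirling.factorial_isEquivalent_stirling.div
    (IsEquivalent.refl (u := fun d : ℕ => √(d : ℝ)) (l := atTop))
  refine (h.congr_right ?_).trans (h1.congr_right ?_)
  · refine eventually_gt_atTop 0 |>.mono fun d hd => ?_
    have hd' : (0 : ℝ) < d := by exact_mod_cast hd
    have h2 := Real.Gamma_add_one hd'.ne'
    rw [Real.Gamma_nat_eq_factorial] at h2
    simp only [Function.comp, Pi.div_apply]
    rw [h2, eq_div_iff (by positivity), mul_right_comm, Real.mul_self_sqrt hd'.le]
  · refine eventually_gt_atTop 0 |>.mono fun d hd => ?_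
    have hd' : (0 : ℝ) < d := by exact_mod_cast hd
    simp only [Pi.div_apply]
    rw [show 2 * (d : ℝ) * Real.pi = 2 * Real.pi * d by ring, Real.sqrt_mul (by positivity)]
    field_simp

/-- This is the half-integer formula at `k = 3 * d`, factored so that its roots cancel those of
`Γ(d/2 + 1)`; `(3 * √3) ^ d` is the root of `27 ^ d`. -/
theorem Gamma_three_halves_add_one_isEquivalent :
    (fun d : ℕ => Real.Gamma (3 * d / 2 + 1)) ~[atTop]
      fun d => √3 * √(Real.pi * d) * ((3 * √3) ^ d * √((d / (2 * Real.exp 1)) ^ d) *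
        (d / (2 * Real.exp 1)) ^ d) := by
  have h := Gamma_half_add_one_isEquivalent.comp_tendsto
    (tendsto_id.const_mul_atTop' (three_pos : 0 < 3))
  refine (h.congr_left (.of_forall fun d => ?_)).congr_right (.of_forall fun d => ?_)
  · simp
  · simp only [Function.comp, id]
    set t : ℝ := d / (2 * Real.exp 1) with ht
    have ht0 : 0 ≤ t := by positivity
    have h1 : ((3 * d : ℕ) : ℝ) / (2 * Real.exp 1) = 3 * t := by
      rw [ht]
      push_cast
      ring
    have h2 : (3 * t) ^ (3 * d) = ((3 * √3) ^ d * t ^ d) ^ 2 * t ^ d := by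
      have h3 : (√3 : ℝ) ^ 2 = 3 := Real.sq_sqrt (by norm_num)
      have h4 : ((3 * √3) ^ d) ^ 2 = (27 : ℝ) ^ d := by
        rw [← pow_mul, mul_comm d, pow_mul, mul_pow, h3]
        norm_num
      rw [mul_pow, mul_pow _ (t ^ d), h4, pow_mul 3]
      norm_num
      ring
    have h5 : √(Real.pi * (3 * d : ℕ)) = √3 * √(Real.pi * d) := by
      rw [← Real.sqrt_mul (by norm_num)]
      push_cast
      congr 1
      ring
    rw [h1, h2, h5, Real.sqrt_mul (sq_nonneg _) (t ^ d), Real.sqrt_sq (by positivity)]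
    ring

/-! ### Asymptotics of the mean and the elongation -/

theorem meanDistPow_unitBall_isEquivalent :
    (fun d : ℕ => meanDistPow d (unitBall d)) ~[atTop]
      fun d => 1 / √6 * (8 / (3 * √3)) ^ d := by
  have h := (IsEquivalent.refl (u := fun d : ℕ => 4 ^ d / (2 * √Real.pi)) (l := atTop)).mul
    ((Gamma_half_add_one_isEquivalent.mul Gamma_natCast_add_half_isEquivalent).div
      Gamma_three_halves_add_one_isEquivalent)
  refine (h.congr_left (eventually_ge_atTop 2 |>.mono fun d hd => ?_)).congr_right
    (eventually_gt_atTop 0 |>.mono fun d hd => ?_)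
  · simp only [Pi.mul_apply, Pi.div_apply]
    rw [meanDistPow_unitBall hd]
  · simp only [Pi.mul_apply, Pi.div_apply]
    have hd' : (0 : ℝ) < d := by exact_mod_cast hd
    rw [show (d : ℝ) / Real.exp 1 = 2 * (d / (2 * Real.exp 1)) by field_simp]
    set t : ℝ := d / (2 * Real.exp 1)
    have ht : 0 < t := by positivity
    -- All powers of `t` cancel; this identity settles the constant `1 / √6`.
    have h6 : √(2 * Real.pi) * √6 = 2 * √3 * √Real.pi := by
      rw [Real.sqrt_mul zero_le_two, show (6 : ℝ) = 2 * 3 by norm_num, Real.sqrt_mul zero_le_two]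
      linear_combination (√Real.pi * √3) * Real.mul_self_sqrt zero_le_two
    have h8 : (8 : ℝ) ^ d = 4 ^ d * 2 ^ d := by rw [← mul_pow]; norm_num
    rw [div_pow 8, h8, mul_pow 2 t]
    have hA : 0 < √(Real.pi * d) := by positivity
    have hB : 0 < √(t ^ d) := by positivity
    field_simp
    linear_combination h6

/-- `Γ(d + 1/2)` cancels between `rhoConst` and the mean. The mean, the reciprocal volume and `Γ(d)`
(by duplication) each supply one factor `Γ(d/2 + 1)`. -/
theorem elongation_unitBall {d : ℕ} (hd : 2 ≤ d) :
    elongation d (unitBall d) =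
      3 / Real.pi * (2 ^ d / d) * (Real.Gamma (d / 2 + 1) ^ 3 / Real.Gamma (3 * d / 2 + 1)) := by
  have hd' : (0 : ℝ) < d := by positivity
  have hG1 : 0 < Real.Gamma ((d : ℝ) / 2 + 1) := Real.Gamma_pos_of_pos (by positivity)
  have hG2 : 0 < Real.Gamma (((d : ℝ) + 1) / 2) := Real.Gamma_pos_of_pos (by positivity)
  have hG3 : 0 < Real.Gamma (3 * (d : ℝ) / 2 + 1) := Real.Gamma_pos_of_pos (by positivity)
  have hG4 : 0 < Real.Gamma ((d : ℝ) + 1 / 2) := Real.Gamma_pos_of_pos (by positivity)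
  have hdup := Gamma_half_add_one_mul_Gamma_half d
  have hfac := Real.Gamma_add_one hd'.ne'
  rw [Real.Gamma_nat_eq_factorial] at hfac
  rw [hfac] at hdup
  have hV : volume.real (unitBall d) = √Real.pi ^ d / Real.Gamma (d / 2 + 1) := by
    rw [measureReal_def, volume_unitBall (by omega), ENNReal.toReal_ofReal (by positivity)]
  have hpi : Real.pi ^ ((d : ℝ) / 2) = √Real.pi ^ d := by
    rw [Real.sqrt_eq_rpow, ← Real.rpow_natCast _ d, ← Real.rpow_mul Real.pi_pos.le]
    congr 1
    ring
  have htwo : (2 : ℝ) ^ (2 * (d : ℝ) - 1) = 4 ^ d / 2 := by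
    rw [Real.rpow_sub_one two_ne_zero, Real.rpow_mul zero_le_two, Real.rpow_natCast]
    norm_num
  rw [elongation, meanDistPow_unitBall hd, hV, rhoConst, hpi, htwo]
  have hs : 0 < √Real.pi := by positivity
  have hs2 : √Real.pi ^ 2 = Real.pi := Real.sq_sqrt Real.pi_pos.le
  have hGd : Real.Gamma d = Real.Gamma (((d : ℝ) + 1) / 2) * Real.Gamma (d / 2 + 1) * 2 ^ d /
      (d * √Real.pi) := by
    rw [hdup]
    field_simp
  rw [hGd]
  field_simp
  rw [hs2]

theorem elongation_unitBall_isEquivalent :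
    (fun d : ℕ => elongation d (unitBall d)) ~[atTop]
      fun d => √3 * (2 / (3 * √3)) ^ d := by
  have h := (IsEquivalent.refl (u := fun d : ℕ => 3 / Real.pi * (2 ^ d / (d : ℝ)))
    (l := atTop)).mul
      ((Gamma_half_add_one_isEquivalent.pow 3).div Gamma_three_halves_add_one_isEquivalent)
  refine (h.congr_left (eventually_ge_atTop 2 |>.mono fun d hd => ?_)).congr_right
    (eventually_gt_atTop 0 |>.mono fun d hd => ?_)
  · simp only [Pi.mul_apply, Pi.div_apply, Pi.pow_apply]
    rw [elongation_unitBall hd]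
  · simp only [Pi.mul_apply, Pi.div_apply, Pi.pow_apply]
    have hd' : (0 : ℝ) < d := by exact_mod_cast hd
    set t : ℝ := d / (2 * Real.exp 1)
    have ht : 0 < t := by positivity
    have hA : 0 < √(Real.pi * d) := by positivity
    have hB : 0 < √(t ^ d) := by positivity
    have hA2 : √(Real.pi * d) ^ 2 = Real.pi * d := Real.sq_sqrt (by positivity)
    have hB2 : √(t ^ d) ^ 2 = t ^ d := Real.sq_sqrt (by positivity)
    have h3 : √3 ^ 2 = (3 : ℝ) := Real.sq_sqrt (by norm_num)
    have hpow : (√(Real.pi * d) * √(t ^ d)) ^ 3 =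
        (Real.pi * d) * t ^ d * √(Real.pi * d) * √(t ^ d) := by
      linear_combination √(Real.pi * d) * √(t ^ d) ^ 3 * hA2 +
        Real.pi * d * √(Real.pi * d) * √(t ^ d) * hB2
    rw [hpow, div_pow 2]
    field_simp
    rw [h3]

/-! ### Transfer to random points -/

theorem integral_norm_sub_pow_eq_meanDistPow {Ω : Type*} [MeasurableSpace Ω] {μ : Measure Ω}
    [IsFiniteMeasure μ] {d : ℕ} (hd : d ≠ 0) {X Y : Ω → EuclideanSpace ℝ (Fin d)}
    (hX : pdf.IsUniform X (unitBall d) μ volume) (hY : pdf.IsUniform Y (unitBall d) μ volume)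
    (hXY : IndepFun X Y μ) :
    ∫ ω, ‖X ω - Y ω‖ ^ d ∂μ = meanDistPow d (unitBall d) := by
  -- A nonzero finite volume is what makes uniform variables a.e. measurable.
  have hpos : volume (unitBall d) ≠ 0 := by
    rw [volume_unitBall hd]
    have : 0 < Real.Gamma ((d : ℝ) / 2 + 1) := Real.Gamma_pos_of_pos (by positivity)
    exact (ENNReal.ofReal_pos.2 (by positivity)).ne'
  have hfin : volume (unitBall d) ≠ ⊤ := by
    rw [volume_unitBall hd]
    exact ENNReal.ofReal_ne_top
  have hXm := hX.aemeasurable hpos hfin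
  have hYm := hY.aemeasurable hpos hfin
  rw [pdf.IsUniform] at hX hY
  have h := (indepFun_iff_map_prod_eq_prod_map_map hXm hYm).1 hXY
  rw [hX, hY] at h
  rw [meanDistPow, ← h, integral_map (hXm.prodMk hYm) (by fun_prop)]

theorem proposition2 {Ω : ℕ → Type*} [∀ d, MeasurableSpace (Ω d)]
    (μ : ∀ d, Measure (Ω d)) [∀ d, IsProbabilityMeasure (μ d)]
    (P₁ P₂ : ∀ d, Ω d → EuclideanSpace ℝ (Fin d))
    (hP₁ : ∀ d, 2 ≤ d → pdf.IsUniform (P₁ d) (unitBall d) (μ d) volume)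
    (hP₂ : ∀ d, 2 ≤ d → pdf.IsUniform (P₂ d) (unitBall d) (μ d) volume)
    (hindep : ∀ d, 2 ≤ d → IndepFun (P₁ d) (P₂ d) (μ d)) :
    ((fun d : ℕ => ∫ ω, ‖P₁ d ω - P₂ d ω‖ ^ d ∂(μ d)) ~[atTop]
        (fun d : ℕ => 1 / Real.sqrt 6 * (8 / (3 * Real.sqrt 3)) ^ d)) ∧
      ((fun d : ℕ => elongation d (unitBall d)) ~[atTop]
        (fun d : ℕ => Real.sqrt 3 * (2 / (3 * Real.sqrt 3)) ^ d)) := by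
  refine ⟨meanDistPow_unitBall_isEquivalent.congr_left ?_, elongation_unitBall_isEquivalent⟩
  filter_upwards [eventually_ge_atTop 2] with d hd
  exact (integral_norm_sub_pow_eq_meanDistPow (by omega) (hP₁ d hd) (hP₂ d hd) (hindep d hd)).symm
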